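/- Consider four punctual bodies with masses $m_1,\dots,m_4\in\mathbb{R}\setminus\{0\}$ at pairwise distinct points $r_1,\dots,r_4$ of the Euclidean plane, and put $$\gamma_i=\sum_{j\ne i} m_j\,\frac{r_j-r_i}{\|r_j-r_i\|^3}.$$ The configuration $(r_1,\dots,r_4)$ is central with multiplier $\xi\in\mathbb{R}$ if $\gamma_j-\gamma_i=\xi\,(r_j-r_i)$ for all $i,j$. Two configurations $(r_i)$, $(r'_i)$ are similar if there is a constant $k>0$ with $\|r'_i-r'_j\|=k\,\|r_i-r_j\|$ for all $i,j$ (bodies are labelled; reflections are allowed). The band of a segment $[a,b]$ is the set of all $w+u$ with $w\in[a,b]$ and $u\perp b-a$. A (non-degenerate) trapezoid, parallelograms being included, is balanced if the band of one of its bases contains the band of the other, unbalanced if the two bands are disjoint, and semi-balanced otherwise. A diamond is a non-degenerate parallelogram with four equal sides. Theorem. Let $x,y$ be non-zero real numbers. There are, up to similarity, exactly two non-collinear planar central configurations with non-zero multiplier for the masses $(m_1,m_2,m_3,m_4)=(x,-x,y,-y)$. Each of them is a semi-balanced trapezoid whose bases (parallel sides) are $[r_1,r_2]$, joining the bodies with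 masses $x$ and $-x$, and $[r_3,r_4]$, joining the bodies with masses $y$ and $-y$. Two bodies on the same diagonal have masses of the same sign. If $|x|>|y|$ then $\|r_2-r_1\|<\|r_4-r_3\|$, and if $|x|<|y|$ then $\|r_4-r_3\|<\|r_2-r_1\|$. If $|x|=|y|$, each of them is a diamond. The two configurations are mirror images of each other: for suitable representatives $(p_i)$, $(q_i)$ of the two similarity classes, there is a line $L$ orthogonal to the bases such that the reflection in $L$ maps $p_1,p_2,p_3,p_4$ to $q_2,q_1,q_4,q_3$ respectively (so each body is exchanged with the body of opposite mass on the same base). -/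

import Mathlib

/-- The Euclidean plane. -/
abbrev Plane : Type := EuclideanSpace ℝ (Fin 2)

namespace NBody

/-- The acceleration `γᵢ = ∑_{j ≠ i} mⱼ (rⱼ - rᵢ) / ‖rⱼ - rᵢ‖³` of body `i`, for punctual bodies
with masses `m` and positions `r` interacting through gravitation. -/
noncomputable def acceleration {N : ℕ} (m : Fin N → ℝ) (r : Fin N → Plane) (i : Fin N) : Plane :=
  ∑ j ∈ Finset.univ.erase i, (m j / ‖r j - r i‖ ^ 3) • (r j - r i)

/-- The bodies are at pairwise distinct positions, and `γⱼ - γᵢ = ξ (rⱼ - rᵢ)` for all `i`, `j`. -/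
def IsCentralWithMultiplier {N : ℕ} (m : Fin N → ℝ) (r : Fin N → Plane) (ξ : ℝ) : Prop :=
  Function.Injective r ∧
    ∀ i j, acceleration m r j - acceleration m r i = ξ • (r j - r i)

/-- Non-collinear central configurations with non-vanishing multiplier. -/
def IsNoncollinearCentral {N : ℕ} (m : Fin N → ℝ) (r : Fin N → Plane) : Prop :=
  ¬ Collinear ℝ (Set.range r) ∧ ∃ ξ : ℝ, ξ ≠ 0 ∧ IsCentralWithMultiplier m r ξ

/-- `a b c d` (in this cyclic order) is a non-degenerate trapezoid whose bases are `[a, b]` and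
`[c, d]` and whose diagonals are `[a, c]` and `[b, d]`. Parallelograms are trapezoids. -/
structure IsTrapezoid (a b c d : Plane) : Prop where
  not_collinear : ¬ Collinear ℝ {a, b, c}
  parallel : (line[ℝ, a, b]).Parallel line[ℝ, c, d]
  diagonals_meet : (segment ℝ a c ∩ segment ℝ b d).Nonempty

/-- The band of the line segment `[a, b]`: all `w + u` with `w` in `[a, b]` and `u ⊥ b - a`. -/
def band (a b : Plane) : Set Plane :=
  {z | ∃ w ∈ segment ℝ a b, ∃ u : Plane, inner ℝ u (b - a) = 0 ∧ z = w + u}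

/-- The trapezoid `a b c d` with bases `[a, b]` and `[c, d]` is balanced. -/
def IsBalanced (a b c d : Plane) : Prop :=
  band a b ⊆ band c d ∨ band c d ⊆ band a b

/-- The trapezoid `a b c d` with bases `[a, b]` and `[c, d]` is unbalanced. -/
def IsUnbalanced (a b c d : Plane) : Prop :=
  band a b ∩ band c d = ∅

/-- `a b c d` is a trapezoid with bases `[a, b]` and `[c, d]`, neither balanced nor unbalanced. -/
def IsSemiBalancedTrapezoid (a b c d : Plane) : Prop :=
  IsTrapezoid a b c d ∧ ¬ IsBalanced a b c d ∧ ¬ IsUnbalanced a b c d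

/-- `a b c d` is a diamond: a non-degenerate parallelogram with four equal sides. -/
def IsDiamond (a b c d : Plane) : Prop :=
  ¬ Collinear ℝ {a, b, c} ∧ b - a = c - d ∧
    dist a b = dist b c ∧ dist b c = dist c d ∧ dist c d = dist d a

/-- The other body of the pair: exchanges bodies `0`, `1` and bodies `2`, `3`. -/
def partner : Fin 4 → Fin 4 := ![1, 0, 3, 2]

end NBody

/-! The sum of the `mᵢ γᵢ` vanishes, so a non-zero multiplier forces `x (r₁ - r₀) + y (r₃ - r₂) =
0`: the segments `[r₀, r₁]` and `[r₂, r₃]` are parallel, with signed ratio fixed by `ρ = x / y`. Off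
a line, the remaining equations say that the inverse cubes of the six distances have equal sums over
the three pairs of opposite edges (`central_iff`).

Let `μ` be the offset along the bases and `ν` the squared distance of the midpoints of the bases, in
units of the first base, and let `P, Q = (1 ± ρ) / 2`. The squared distances are `ν + P² ± 2μP`, `ν
+ Q² ± 2μQ` and, for the bases, `(P ± Q)²`. By convexity of the inverse cube, a level curve of
`pairSum` is a graph `m = M δ` with `M` convex and increasing on `δ ≥ 0` (`exists_levelCurve`). The
equations become `ν + P² = M (2μP)` and `ν + Q² = M (2μQ)`. Eliminating `ν` leaves `M (2μP) - M
(2μQ) = P² - Q²`. After reduction to `P > Q ≥ 0` and `μ ≥ 0`, the left side increases strictly with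
`μ` (`increment_strictMonoOn`), and the intermediate value theorem places the only root in `(Q, P)`.

The two signs of `μ` give the two mirror images, and the bounds on `|μ|` are those of a
semi-balanced trapezoid. -/

namespace NBody

/-! ### Convexity of the inverse cube and of its two-point sums -/

/-- The inverse cube of a distance, as a function of the squared distance. -/
noncomputable def invCube (s : ℝ) : ℝ := s ^ (-(3 / 2) : ℝ)

lemma invCube_pos {s : ℝ} (hs : 0 < s) : 0 < invCube s := Real.rpow_pos_of_pos hs _

lemma invCube_strictAntiOn : StrictAntiOn invCube (Set.Ioi 0) :=
  Real.strictAntiOn_rpow_Ioi_of_exponent_neg (by norm_num)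

lemma invCube_lt_iff {s t : ℝ} (hs : 0 < s) (ht : 0 < t) : invCube s < invCube t ↔ t < s :=
  invCube_strictAntiOn.lt_iff_gt hs ht

lemma invCube_continuousOn : ContinuousOn invCube (Set.Ioi 0) := fun s hs =>
  (Real.continuousAt_rpow_const s _ (Or.inl (ne_of_gt hs))).continuousWithinAt

lemma invCube_strictConvexOn : StrictConvexOn ℝ (Set.Ioi 0) invCube := by
  refine StrictMonoOn.strictConvexOn_of_deriv (convex_Ioi 0) invCube_continuousOn ?_
  rw [interior_Ioi]
  have hd : ∀ s ∈ Set.Ioi (0 : ℝ), deriv invCube s = -(3 / 2) * s ^ (-(5 / 2) : ℝ) := by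
    intro s hs
    have h := (Real.hasDerivAt_rpow_const (p := (-(3 / 2) : ℝ)) (Or.inl (ne_of_gt hs))).deriv
    rw [show (-(5 / 2) : ℝ) = -(3 / 2) - 1 by norm_num]
    exact h
  intro s hs t ht hst
  rw [hd s hs, hd t ht]
  have := Real.strictAntiOn_rpow_Ioi_of_exponent_neg (r := (-(5 / 2) : ℝ)) (by norm_num) hs ht hst
  simp only at this
  linarith

lemma invCube_mul {s t : ℝ} (hs : 0 ≤ s) (ht : 0 ≤ t) :
    invCube (s * t) = invCube s * invCube t := Real.mul_rpow hs ht

lemma invCube_sq {d : ℝ} (hd : 0 ≤ d) : invCube (d ^ 2) = (d ^ 3)⁻¹ := by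
  rw [invCube, ← Real.rpow_natCast d 2, ← Real.rpow_mul hd, ← Real.rpow_natCast d 3,
    ← Real.rpow_neg hd]
  norm_num

lemma invCube_one : invCube 1 = 1 := Real.one_rpow _

lemma exists_invCube_eq {κ : ℝ} (hκ : 0 < κ) : ∃ s, 0 < s ∧ invCube s = κ := by
  refine ⟨κ ^ (-(2 / 3) : ℝ), Real.rpow_pos_of_pos hκ _, ?_⟩
  rw [invCube, ← Real.rpow_mul hκ.le]
  norm_num

/-- The sum of the inverse cubes of two distances whose squares are `m + δ` and `m - δ`. -/
noncomputable def pairSum (m δ : ℝ) : ℝ := invCube (m + δ) + invCube (m - δ)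

lemma pairSum_neg (m δ : ℝ) : pairSum m (-δ) = pairSum m δ := by
  rw [pairSum, pairSum, sub_neg_eq_add, ← sub_eq_add_neg, add_comm]

lemma pairSum_abs (m δ : ℝ) : pairSum m |δ| = pairSum m δ := by
  rcases abs_choice δ with h | h <;> rw [h]
  exact pairSum_neg m δ

lemma pairSum_lt_of_lt {m m' δ : ℝ} (h : |δ| < m) (hm : m < m') : pairSum m' δ < pairSum m δ := by
  have h' := abs_lt.1 h
  have h1 := (invCube_lt_iff (s := m' + δ) (t := m + δ) (by linarith) (by linarith)).2 (by linarith)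
  have h2 := (invCube_lt_iff (s := m' - δ) (t := m - δ) (by linarith) (by linarith)).2 (by linarith)
  exact add_lt_add h1 h2

lemma pairSum_lt_of_abs_lt {m δ δ' : ℝ} (h0 : 0 ≤ δ) (h : δ < δ') (hm : δ' < m) :
    pairSum m δ < pairSum m δ' := by
  have hδ' : 0 < δ' := h0.trans_lt h
  have ha : 0 < (δ' + δ) / (2 * δ') := by positivity
  have hb : 0 < (δ' - δ) / (2 * δ') := div_pos (by linarith) (by positivity)
  have hab : (δ' + δ) / (2 * δ') + (δ' - δ) / (2 * δ') = 1 := by field_simp; ring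
  have h1 : m + δ' ∈ Set.Ioi (0 : ℝ) := by simp only [Set.mem_Ioi]; linarith
  have h2 : m - δ' ∈ Set.Ioi (0 : ℝ) := by simp only [Set.mem_Ioi]; linarith
  have hne : m + δ' ≠ m - δ' := by intro h; linarith
  -- Both `m + δ` and `m - δ` are averages of `m ± δ'`, with the same two weights interchanged.
  -- Adding the two strict inequalities restores total weight one on each endpoint.
  have e1 := invCube_strictConvexOn.2 h1 h2 hne ha hb hab
  have e2 := invCube_strictConvexOn.2 h2 h1 hne.symm ha hb hab
  simp only [smul_eq_mul] at e1 e2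
  rw [show (δ' + δ) / (2 * δ') * (m + δ') + (δ' - δ) / (2 * δ') * (m - δ') = m + δ by
    field_simp; ring] at e1
  rw [show (δ' + δ) / (2 * δ') * (m - δ') + (δ' - δ) / (2 * δ') * (m + δ') = m - δ by
    field_simp; ring] at e2
  have hb' : (δ' - δ) / (2 * δ') = 1 - (δ' + δ) / (2 * δ') := by linarith
  rw [hb'] at e1 e2
  unfold pairSum
  nlinarith

lemma pairSum_convex {m m' δ δ' a b : ℝ} (h : |δ| < m) (h' : |δ'| < m') (ha : 0 ≤ a) (hb : 0 ≤ b)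
    (hab : a + b = 1) :
    pairSum (a * m + b * m') (a * δ + b * δ') ≤ a * pairSum m δ + b * pairSum m' δ' := by
  have k := abs_lt.1 h
  have k' := abs_lt.1 h'
  have e1 := invCube_strictConvexOn.convexOn.2 (x := m + δ) (y := m' + δ')
    (by simp only [Set.mem_Ioi]; linarith) (by simp only [Set.mem_Ioi]; linarith) ha hb hab
  have e2 := invCube_strictConvexOn.convexOn.2 (x := m - δ) (y := m' - δ')
    (by simp only [Set.mem_Ioi]; linarith) (by simp only [Set.mem_Ioi]; linarith) ha hb hab
  simp only [smul_eq_mul] at e1 e2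
  rw [show a * (m + δ) + b * (m' + δ') = a * m + b * m' + (a * δ + b * δ') by ring] at e1
  rw [show a * (m - δ) + b * (m' - δ') = a * m + b * m' - (a * δ + b * δ') by ring] at e2
  unfold pairSum
  linarith

/-! ### Level curves of `pairSum` -/

lemma exists_pairSum_eq {κ : ℝ} (hκ : 0 < κ) (δ : ℝ) : ∃ m, |δ| < m ∧ pairSum m δ = κ := by
  -- At `m = |δ| + s` the nearer term alone is `κ`; at `m = |δ| + t` neither term exceeds `κ / 2`.
  -- These values bracket the solution.
  obtain ⟨s, hs, hsκ⟩ := exists_invCube_eq hκ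
  obtain ⟨t, ht, htκ⟩ := exists_invCube_eq (half_pos hκ)
  have hst : s < t := (invCube_lt_iff ht hs).1 (by linarith)
  have hcont : ContinuousOn (fun m => pairSum m |δ|) (Set.Icc (|δ| + s) (|δ| + t)) := by
    have hδ := abs_nonneg δ
    refine (invCube_continuousOn.comp (by fun_prop) ?_).add
      (invCube_continuousOn.comp (by fun_prop) ?_) <;>
    · intro m hm
      have := hm.1
      simp only [Set.mem_Ioi]
      linarith
  have h1 : κ ≤ pairSum (|δ| + s) |δ| := by
    have : 0 < invCube (|δ| + s + |δ|) := invCube_pos (by positivity)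
    rw [pairSum, add_sub_cancel_left]
    linarith
  have h2 : pairSum (|δ| + t) |δ| ≤ κ := by
    have : invCube (|δ| + t + |δ|) ≤ invCube t :=
      invCube_strictAntiOn.antitoneOn ht (by simp only [Set.mem_Ioi]; positivity)
        (by linarith [abs_nonneg δ])
    rw [pairSum, add_sub_cancel_left]
    linarith
  obtain ⟨m, hm, hmκ⟩ := intermediate_value_Icc' (by linarith) hcont ⟨h2, h1⟩
  exact ⟨m, by linarith [hm.1], by rw [← pairSum_abs]; exact hmκ⟩

/-- A level curve of `pairSum` is the graph of an even convex function. -/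
lemma exists_levelCurve {κ : ℝ} (hκ : 0 < κ) : ∃ M : ℝ → ℝ, (∀ δ, |δ| < M δ) ∧
    (∀ m δ, |δ| < m → (pairSum m δ = κ ↔ m = M δ)) ∧ ConvexOn ℝ Set.univ M ∧
    StrictMonoOn M (Set.Ici 0) := by
  choose M hM hMκ using exists_pairSum_eq hκ
  -- The sublevel set of `pairSum` lies in the epigraph of `M`, so convexity of `pairSum` passes to
  -- `M`.
  have hle : ∀ m δ, |δ| < m → pairSum m δ ≤ κ → M δ ≤ m := by
    intro m δ hm h
    by_contra! hlt
    have := pairSum_lt_of_lt hm hlt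
    linarith [hMκ δ]
  refine ⟨M, hM, fun m δ hm => ⟨fun h => ?_, fun h => h ▸ hMκ δ⟩,
    ⟨convex_univ, fun δ _ δ' _ a b ha hb hab => ?_⟩, fun δ hδ δ' _ hlt => ?_⟩
  · refine le_antisymm ?_ (hle m δ hm h.le)
    by_contra! hlt
    have := pairSum_lt_of_lt (hM δ) hlt
    linarith [hMκ δ]
  · simp only [smul_eq_mul]
    refine hle _ _ ?_ ?_
    · have h1 := abs_lt.1 (hM δ)
      have h2 := abs_lt.1 (hM δ')
      have hb' : b = 1 - a := by linarith
      subst hb'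
      rcases ha.eq_or_lt with rfl | ha
      · simpa using hM δ'
      · rw [abs_lt]; constructor <;> nlinarith
    · have := pairSum_convex (hM δ) (hM δ') ha hb hab
      rw [hMκ, hMκ, ← add_mul, hab, one_mul] at this
      exact this
  · by_contra! hle'
    have hδ : (0 : ℝ) ≤ δ := hδ
    have h1 : δ' < M δ' := (le_abs_self δ').trans_lt (hM δ')
    have h2 := pairSum_lt_of_abs_lt hδ hlt (h1.trans_le hle')
    rw [hMκ] at h2
    rcases hle'.eq_or_lt with h | h
    · rw [← h, hMκ] at h2
      exact h2.false
    · have := pairSum_lt_of_lt (hM δ') h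
      rw [hMκ] at this
      linarith

/-- For `v < w`, the points `2vp` and `2wq` lie between `2vq` and `2wp`, with weights `a` and `b` on
the latter. Convexity bounds the sum of their values, and `a + b < 1` together with monotonicity of
`M` makes the comparison strict. -/
lemma increment_strictMonoOn {M : ℝ → ℝ} (hM : ConvexOn ℝ Set.univ M)
    (hmono : StrictMonoOn M (Set.Ici 0)) {p q : ℝ} (hq : 0 ≤ q) (hpq : q < p) :
    StrictMonoOn (fun v => M (2 * v * p) - M (2 * v * q)) (Set.Ici 0) := by
  intro v hv w _ hvw
  have hv : (0 : ℝ) ≤ v := hv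
  have hp : 0 < p := hq.trans_lt hpq
  have hw : 0 < w := hv.trans_lt hvw
  have hD : 0 < w * p - v * q := by nlinarith
  have hcomb : ∀ a b, 0 ≤ a → 0 ≤ b → a + b = 1 →
      M (a * (2 * w * p) + b * (2 * v * q)) ≤ a * M (2 * w * p) + b * M (2 * v * q) :=
    fun a b ha hb hab => hM.2 (Set.mem_univ _) (Set.mem_univ _) ha hb hab
  have h3 : M (2 * v * q) < M (2 * w * p) :=
    hmono (by simp only [Set.mem_Ici]; positivity) (by simp only [Set.mem_Ici]; positivity)
      (by linarith)
  set a := (v * p - v * q) / (w * p - v * q) with ha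
  set b := (w * q - v * q) / (w * p - v * q) with hb
  have ha' : a * (w * p - v * q) = v * p - v * q := div_mul_cancel₀ _ hD.ne'
  have hb' : b * (w * p - v * q) = w * q - v * q := div_mul_cancel₀ _ hD.ne'
  have hab : a + b < 1 := by
    rw [ha, hb, ← add_div, div_lt_one hD]
    nlinarith
  have ha0 : 0 ≤ a := div_nonneg (by nlinarith) hD.le
  have hb0 : 0 ≤ b := div_nonneg (by nlinarith) hD.le
  have h1 := hcomb a (1 - a) ha0 (by linarith) (by ring)
  have h2 := hcomb b (1 - b) hb0 (by linarith) (by ring)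
  rw [show a * (2 * w * p) + (1 - a) * (2 * v * q) = 2 * v * p by linear_combination 2 * ha'] at h1
  rw [show b * (2 * w * p) + (1 - b) * (2 * v * q) = 2 * w * q by linear_combination 2 * hb'] at h2
  simp only
  nlinarith

/-! ### Unique solvability of the trapezoid equations -/

/-- The equations for the normalised position `μ` and the normalised squared distance `ν` of the
midpoints of the bases. -/
def TrapezoidEquations (P Q μ ν : ℝ) : Prop :=
  μ ^ 2 < ν ∧ pairSum (ν + P ^ 2) (2 * μ * P) = pairSum (P ^ 2 + Q ^ 2) (2 * P * Q) ∧
    pairSum (ν + Q ^ 2) (2 * μ * Q) = pairSum (P ^ 2 + Q ^ 2) (2 * P * Q)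

lemma abs_two_mul_lt {P μ ν : ℝ} (h : μ ^ 2 < ν) : |2 * μ * P| < ν + P ^ 2 := by
  rw [abs_lt]
  constructor <;> nlinarith [sq_nonneg (μ + P), sq_nonneg (μ - P)]

lemma TrapezoidEquations.swap {P Q μ ν : ℝ} (h : TrapezoidEquations P Q μ ν) :
    TrapezoidEquations Q P μ ν := by
  refine ⟨h.1, ?_, ?_⟩
  · rw [h.2.2, add_comm (P ^ 2), mul_right_comm]
  · rw [h.2.1, add_comm (P ^ 2), mul_right_comm]

lemma trapezoidEquations_abs (P Q μ ν : ℝ) :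
    TrapezoidEquations |P| |Q| |μ| ν ↔ TrapezoidEquations P Q μ ν := by
  have h : ∀ m a b : ℝ, pairSum m (2 * |a| * |b|) = pairSum m (2 * a * b) := by
    intro m a b
    rw [← pairSum_abs m (2 * a * b), abs_mul, abs_mul, abs_two]
  simp only [TrapezoidEquations, sq_abs, h]

lemma trapezoidEquations_unique_of_lt {p q : ℝ} (hq : 0 ≤ q) (hpq : q < p) :
    ∃ μ₀ ν₀, q < μ₀ ∧ μ₀ < p ∧ ∀ μ ν, 0 ≤ μ →
      (TrapezoidEquations p q μ ν ↔ μ = μ₀ ∧ ν = ν₀) := by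
  have hp : 0 < p := hq.trans_lt hpq
  have habs : |2 * p * q| < p ^ 2 + q ^ 2 := by
    rw [abs_of_nonneg (by positivity)]
    nlinarith [sq_pos_of_pos (sub_pos.2 hpq)]
  have hκ : 0 < pairSum (p ^ 2 + q ^ 2) (2 * p * q) := by
    have := abs_lt.1 habs
    exact add_pos (invCube_pos (by linarith)) (invCube_pos (by linarith))
  obtain ⟨M, hM, hiff, hconv, hmono⟩ := exists_levelCurve hκ
  have hmid : M (2 * p * q) = p ^ 2 + q ^ 2 := ((hiff _ _ habs).1 rfl).symm
  have hMc : Continuous M := continuousOn_univ.1 (hconv.continuousOn isOpen_univ)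
  have hH := increment_strictMonoOn hconv hmono hq hpq
  -- Both end values follow from `|δ| < M δ` and the known value of `M` at `2pq`.
  have hup : p ^ 2 - q ^ 2 < M (2 * p * p) - M (2 * p * q) := by
    have := (le_abs_self _).trans_lt (hM (2 * p * p))
    rw [hmid]
    nlinarith
  have hlow : M (2 * q * p) - M (2 * q * q) < p ^ 2 - q ^ 2 := by
    have := (le_abs_self _).trans_lt (hM (2 * q * q))
    rw [mul_right_comm 2 q p, hmid]
    nlinarith
  obtain ⟨μ₀, hμ₀, hμ₀eq⟩ := intermediate_value_Ioo hpq.le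
    (f := fun v => M (2 * v * p) - M (2 * v * q)) (by fun_prop) ⟨hlow, hup⟩
  simp only at hμ₀eq
  have hμ₀pos : 0 ≤ μ₀ := hq.trans hμ₀.1.le
  refine ⟨μ₀, M (2 * μ₀ * p) - p ^ 2, hμ₀.1, hμ₀.2, fun μ ν hμ => ⟨fun h => ?_, ?_⟩⟩
  · have h1 := (hiff _ _ (abs_two_mul_lt h.1)).1 h.2.1
    have h2 := (hiff _ _ (abs_two_mul_lt h.1)).1 h.2.2
    have : μ = μ₀ := hH.injOn hμ hμ₀pos (by linarith)
    subst this
    exact ⟨rfl, by linarith⟩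
  · rintro ⟨rfl, rfl⟩
    have e1 : M (2 * μ * p) - p ^ 2 + p ^ 2 = M (2 * μ * p) := by ring
    have e2 : M (2 * μ * p) - p ^ 2 + q ^ 2 = M (2 * μ * q) := by linarith
    refine ⟨?_, ?_, ?_⟩
    -- This is `μ ^ 2 < ν`. Otherwise `pairSum (μ² + q²) (2μq)` would be at most its value at `μ =
    -- p`, although `q < μ < p` makes both `(μ ± q)²` smaller than `(p ± q)²`.
    · have hneg : M (2 * μ * q) > μ ^ 2 + q ^ 2 := by
        by_contra! hle
        have hlt : |2 * μ * q| < μ ^ 2 + q ^ 2 := (hM _).trans_le hle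
        have hle2 : pairSum (μ ^ 2 + q ^ 2) (2 * μ * q) ≤ pairSum (p ^ 2 + q ^ 2) (2 * p * q) := by
          have hk := (hiff _ _ (hM (2 * μ * q))).2 rfl
          rcases hle.eq_or_lt with h | h
          · rw [← h, hk]
          · rw [← hk]; exact (pairSum_lt_of_lt (hM _) h).le
        have h1 : invCube ((p + q) ^ 2) < invCube ((μ + q) ^ 2) :=
          (invCube_lt_iff (sq_pos_of_pos (by linarith)) (sq_pos_of_pos (by linarith [hμ₀.1]))).2
            (by nlinarith [hμ₀.1, hμ₀.2])
        have h2 : invCube ((p - q) ^ 2) < invCube ((μ - q) ^ 2) :=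
          (invCube_lt_iff (sq_pos_of_pos (by linarith)) (sq_pos_of_pos (by linarith [hμ₀.1]))).2
            (by nlinarith [hμ₀.1, hμ₀.2])
        unfold pairSum at hle2
        rw [show μ ^ 2 + q ^ 2 + 2 * μ * q = (μ + q) ^ 2 by ring,
          show μ ^ 2 + q ^ 2 - 2 * μ * q = (μ - q) ^ 2 by ring,
          show p ^ 2 + q ^ 2 + 2 * p * q = (p + q) ^ 2 by ring,
          show p ^ 2 + q ^ 2 - 2 * p * q = (p - q) ^ 2 by ring] at hle2
        linarith
      linarith
    · rw [e1]; exact (hiff _ _ (hM _)).2 rfl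
    · rw [e2]; exact (hiff _ _ (hM _)).2 rfl

lemma trapezoidEquations_unique {P Q : ℝ} (h : |P| ≠ |Q|) :
    ∃ μ₀ ν₀, min |P| |Q| < μ₀ ∧ μ₀ < max |P| |Q| ∧ ∀ μ ν,
      (TrapezoidEquations P Q μ ν ↔ |μ| = μ₀ ∧ ν = ν₀) := by
  rcases h.lt_or_gt with h | h
  · obtain ⟨μ₀, ν₀, h1, h2, H⟩ := trapezoidEquations_unique_of_lt (abs_nonneg P) h
    refine ⟨μ₀, ν₀, by rwa [min_eq_left h.le], by rwa [max_eq_right h.le], fun μ ν => ?_⟩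
    rw [← H _ _ (abs_nonneg μ), ← trapezoidEquations_abs]
    exact ⟨fun h => h.swap, fun h => h.swap⟩
  · obtain ⟨μ₀, ν₀, h1, h2, H⟩ := trapezoidEquations_unique_of_lt (abs_nonneg Q) h
    refine ⟨μ₀, ν₀, by rwa [min_eq_right h.le], by rwa [max_eq_left h.le], fun μ ν => ?_⟩
    rw [← H _ _ (abs_nonneg μ), ← trapezoidEquations_abs]

/-! ### Linear algebra in the plane -/

/-- The determinant of two vectors of the plane. -/
def cross (v w : Plane) : ℝ := v 0 * w 1 - v 1 * w 0

lemma plane_inner (v w : Plane) : inner ℝ v w = v 0 * w 0 + v 1 * w 1 := by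
  simp [PiLp.inner_apply, Fin.sum_univ_two, mul_comm]

lemma plane_norm_sq (v : Plane) : ‖v‖ ^ 2 = v 0 ^ 2 + v 1 ^ 2 := by
  rw [EuclideanSpace.norm_sq_eq, Fin.sum_univ_two, Real.norm_eq_abs, Real.norm_eq_abs, sq_abs,
    sq_abs]

lemma cross_sq (v w : Plane) : cross v w ^ 2 = ‖v‖ ^ 2 * ‖w‖ ^ 2 - inner ℝ v w ^ 2 := by
  rw [plane_norm_sq, plane_norm_sq, plane_inner, cross]
  ring

lemma eq_zero_of_smul_add_smul_eq_zero {v w : Plane} (h : cross v w ≠ 0) {s t : ℝ}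
    (hst : s • v + t • w = 0) : s = 0 ∧ t = 0 := by
  have h0 := congrArg (fun z : Plane => z 0) hst
  have h1 := congrArg (fun z : Plane => z 1) hst
  simp only [PiLp.add_apply, PiLp.smul_apply, smul_eq_mul, PiLp.zero_apply] at h0 h1
  refine ⟨(mul_eq_zero.1 ?_).resolve_right h, (mul_eq_zero.1 ?_).resolve_right h⟩
  · unfold cross; linear_combination w 1 * h0 - w 0 * h1
  · unfold cross; linear_combination v 0 * h1 - v 1 * h0

lemma cross_smul_smul (s t : ℝ) (v : Plane) : cross (s • v) (t • v) = 0 := by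
  simp only [cross, PiLp.smul_apply, smul_eq_mul]
  ring

lemma cross_eq_zero_of_collinear {s : Set Plane} (hs : Collinear ℝ s) {a b c : Plane}
    (ha : a ∈ s) (hb : b ∈ s) (hc : c ∈ s) : cross (b - a) (c - a) = 0 := by
  obtain ⟨v, hv⟩ := (collinear_iff_of_mem ha).1 hs
  obtain ⟨t, ht⟩ := hv b hb
  obtain ⟨u, hu⟩ := hv c hc
  rw [ht, hu]
  simp only [vadd_eq_add, add_sub_cancel_right, cross_smul_smul]

lemma exists_eq_smul_of_cross_eq_zero {v w : Plane} (hv : v ≠ 0) (h : cross v w = 0) :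
    ∃ t : ℝ, w = t • v := by
  have hn : v 0 ^ 2 + v 1 ^ 2 ≠ 0 := by
    rw [← plane_norm_sq]
    exact pow_ne_zero 2 (norm_ne_zero_iff.2 hv)
  unfold cross at h
  refine ⟨(v 0 * w 0 + v 1 * w 1) / (v 0 ^ 2 + v 1 ^ 2), ?_⟩
  ext i
  fin_cases i <;>
    simp only [Fin.zero_eta, Fin.mk_one, PiLp.smul_apply, smul_eq_mul] <;> field_simp
  · linear_combination -v 1 * h
  · linear_combination v 0 * h

/-! ### Central configurations as equations between weights -/

/-- The inverse cube of the distance between two bodies. -/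
noncomputable def weight (r : Fin 4 → Plane) (i j : Fin 4) : ℝ := invCube (dist (r i) (r j) ^ 2)

lemma weight_comm (r : Fin 4 → Plane) (i j : Fin 4) : weight r i j = weight r j i := by
  rw [weight, weight, dist_comm]

lemma acceleration_eq (m : Fin 4 → ℝ) (r : Fin 4 → Plane) (i : Fin 4) :
    acceleration m r i = ∑ j, (m j * weight r i j) • (r j - r i) := by
  rw [acceleration, ← Finset.add_sum_erase _ _ (Finset.mem_univ i), sub_self, smul_zero, zero_add]
  refine Finset.sum_congr rfl fun j _ => ?_
  rw [weight, invCube_sq dist_nonneg, dist_comm, dist_eq_norm, div_eq_mul_inv]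

section

variable {x y : ℝ} {r : Fin 4 → Plane}

lemma acceleration_zero : acceleration ![x, -x, y, -y] r 0 = (-x * weight r 0 1) • (r 1 - r 0) +
    (y * weight r 0 2) • (r 2 - r 0) + (-y * weight r 0 3) • (r 3 - r 0) := by
  rw [acceleration_eq, Fin.sum_univ_four]
  simp

lemma acceleration_one : acceleration ![x, -x, y, -y] r 1 = (x * weight r 0 1) • (r 0 - r 1) +
    (y * weight r 1 2) • (r 2 - r 1) + (-y * weight r 1 3) • (r 3 - r 1) := by
  rw [acceleration_eq, Fin.sum_univ_four, weight_comm r 0 1]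
  simp

lemma acceleration_two : acceleration ![x, -x, y, -y] r 2 = (x * weight r 0 2) • (r 0 - r 2) +
    (-x * weight r 1 2) • (r 1 - r 2) + (-y * weight r 2 3) • (r 3 - r 2) := by
  rw [acceleration_eq, Fin.sum_univ_four, weight_comm r 0 2, weight_comm r 1 2]
  simp

lemma acceleration_three : acceleration ![x, -x, y, -y] r 3 = (x * weight r 0 3) • (r 0 - r 3) +
    (-x * weight r 1 3) • (r 1 - r 3) + (y * weight r 2 3) • (r 2 - r 3) := by
  rw [acceleration_eq, Fin.sum_univ_four, weight_comm r 0 3, weight_comm r 1 3, weight_comm r 2 3]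
  simp

/-- Action and reaction cancel in the sum of the `mᵢ γᵢ`; as the total mass is zero, this sum
involves only the differences within each pair. -/
lemma center_eq_zero {ξ : ℝ} (hξ : ξ ≠ 0)
    (h : ∀ i j, acceleration ![x, -x, y, -y] r j - acceleration ![x, -x, y, -y] r i =
      ξ • (r j - r i)) : x • (r 1 - r 0) + y • (r 3 - r 2) = 0 := by
  have h1 := h 0 1
  have h2 := h 2 3
  have h3 : x • (acceleration ![x, -x, y, -y] r 1 - acceleration ![x, -x, y, -y] r 0) +
      y • (acceleration ![x, -x, y, -y] r 3 - acceleration ![x, -x, y, -y] r 2) = 0 := by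
    rw [acceleration_zero, acceleration_one, acceleration_two, acceleration_three]
    module
  rw [h1, h2] at h3
  have h4 : ξ • (x • (r 1 - r 0) + y • (r 3 - r 2)) = 0 := by rw [← h3]; module
  exact (smul_eq_zero.1 h4).resolve_left hξ

/-- The equations of central configurations, the position of the last body being determined by
the vanishing of the sum of the `mᵢ rᵢ`. -/
lemma central_iff {ρ ξ : ℝ} (hy : y ≠ 0) (hr : r 3 = r 2 - ρ • (r 1 - r 0)) (hρ : x = ρ * y)
    (hc : cross (r 1 - r 0) (r 2 - r 0) ≠ 0) (hρ0 : ρ ≠ 0) :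
    (∀ i j, acceleration ![x, -x, y, -y] r j - acceleration ![x, -x, y, -y] r i =
      ξ • (r j - r i)) ↔
    weight r 0 1 + weight r 2 3 = weight r 0 2 + weight r 1 3 ∧
    weight r 0 1 + weight r 2 3 = weight r 0 3 + weight r 1 2 ∧
    ξ = y * (ρ * (weight r 1 2 - weight r 0 2) + (weight r 0 3 - weight r 0 2)) := by
  have h0 := acceleration_zero (x := x) (y := y) (r := r)
  have h1 := acceleration_one (x := x) (y := y) (r := r)
  have h2 := acceleration_two (x := x) (y := y) (r := r)
  have h3 := acceleration_three (x := x) (y := y) (r := r)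
  generalize weight r 0 1 = s01 at *
  generalize weight r 0 2 = s02 at *
  generalize weight r 0 3 = s03 at *
  generalize weight r 1 2 = s12 at *
  generalize weight r 1 3 = s13 at *
  generalize weight r 2 3 = s23 at *
  subst hρ
  constructor
  · intro h
    have e1 := h 0 1
    have e2 := h 0 2
    rw [h0, h1, hr] at e1
    rw [h0, h2, hr] at e2
    -- Coordinates are taken in the basis `r 1 - r 0`, `r 2 - r 0`.
    obtain ⟨-, e1⟩ := eq_zero_of_smul_add_smul_eq_zero hc
      (s := -y * s12 + (ρ + 1) * y * s13 - ρ * y * s03 - ξ) (t := y * (s12 - s13 - s02 + s03))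
      (by rw [← sub_eq_zero] at e1; rw [← e1]; module)
    obtain ⟨e2, e3⟩ := eq_zero_of_smul_add_smul_eq_zero hc
      (s := ρ * y * (s23 - s12 + s01 - s03))
      (t := y * (ρ * (s12 - s02) + (s03 - s02)) - ξ)
      (by rw [← sub_eq_zero] at e2; rw [← e2]; module)
    have e1' := (mul_eq_zero.1 e1).resolve_left hy
    have e2' := (mul_eq_zero.1 e2).resolve_left (mul_ne_zero hρ0 hy)
    exact ⟨by linarith, by linarith, by linarith⟩
  · rintro ⟨e1, e2, rfl⟩
    have f1 : s13 = s12 + s03 - s02 := by linarith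
    have f2 : s01 = s03 + s12 - s23 := by linarith
    subst f1 f2
    -- It suffices that `γᵢ - ξ (rᵢ - r₀)` does not depend on `i`.
    have key : ∀ i, acceleration ![ρ * y, -(ρ * y), y, -y] r i -
        (y * (ρ * (s12 - s02) + (s03 - s02))) • (r i - r 0) =
        acceleration ![ρ * y, -(ρ * y), y, -y] r 0 := by
      intro i
      fin_cases i
      · simp
      · simp only [Fin.mk_one]
        rw [h0, h1, hr]
        module
      · simp only [Fin.reduceFinMk]
        rw [h0, h2, hr]
        module
      · simp only [Fin.reduceFinMk]
        rw [h0, h3, hr]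
        module
    intro i j
    have hi := key i
    have hj := key j
    rw [← hj, sub_eq_iff_eq_add] at hi
    rw [hi]
    module

end

/-! ### Distances in terms of the midpoints of the bases -/

/-- The vector from the midpoint of the first base to the midpoint of the second one. -/
noncomputable def midVec (r : Fin 4 → Plane) : Plane :=
  (1 / 2 : ℝ) • (r 2 + r 3) - (1 / 2 : ℝ) • (r 0 + r 1)

/-- The component of `midVec` along the bases, relative to the length of the first base. -/
noncomputable def midOffset (r : Fin 4 → Plane) : ℝ :=
  inner ℝ (midVec r) (r 1 - r 0) / ‖r 1 - r 0‖ ^ 2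

/-- The squared length of `midVec`, relative to that of the first base. -/
noncomputable def midSq (r : Fin 4 → Plane) : ℝ := ‖midVec r‖ ^ 2 / ‖r 1 - r 0‖ ^ 2

section

variable {r : Fin 4 → Plane} {ρ : ℝ}

/-- A vector from a body of the first base to one of the second has this form, with `t` equal to
`±(1 + ρ) / 2` on `02`, `13` and `±(1 - ρ) / 2` on `03`, `12`. -/
lemma norm_midVec_add_smul_sq (h : r 1 - r 0 ≠ 0) (t : ℝ) :
    ‖midVec r + t • (r 1 - r 0)‖ ^ 2 =
      ‖r 1 - r 0‖ ^ 2 * (midSq r + t ^ 2 + 2 * midOffset r * t) := by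
  have hn : ‖r 1 - r 0‖ ≠ 0 := norm_ne_zero_iff.2 h
  rw [norm_add_sq_real, inner_smul_right, norm_smul, mul_pow, Real.norm_eq_abs, sq_abs, midSq,
    midOffset]
  field_simp
  ring

lemma dist_sq_zero_two (h : r 1 - r 0 ≠ 0) (hr : r 3 = r 2 - ρ • (r 1 - r 0)) :
    dist (r 0) (r 2) ^ 2 = ‖r 1 - r 0‖ ^ 2 *
      (midSq r + ((1 + ρ) / 2) ^ 2 + 2 * midOffset r * ((1 + ρ) / 2)) := by
  rw [← norm_midVec_add_smul_sq h, dist_comm, dist_eq_norm, midVec, hr]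
  congr 2
  module

lemma dist_sq_one_three (h : r 1 - r 0 ≠ 0) (hr : r 3 = r 2 - ρ • (r 1 - r 0)) :
    dist (r 1) (r 3) ^ 2 = ‖r 1 - r 0‖ ^ 2 *
      (midSq r + ((1 + ρ) / 2) ^ 2 - 2 * midOffset r * ((1 + ρ) / 2)) := by
  rw [sub_eq_add_neg _ (_ * _), ← mul_neg, ← neg_sq ((1 + ρ) / 2), ← norm_midVec_add_smul_sq h,
    dist_comm, dist_eq_norm, midVec, hr]
  congr 2
  module

lemma dist_sq_zero_three (h : r 1 - r 0 ≠ 0) (hr : r 3 = r 2 - ρ • (r 1 - r 0)) :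
    dist (r 0) (r 3) ^ 2 = ‖r 1 - r 0‖ ^ 2 *
      (midSq r + ((1 - ρ) / 2) ^ 2 + 2 * midOffset r * ((1 - ρ) / 2)) := by
  rw [← norm_midVec_add_smul_sq h, dist_comm, dist_eq_norm, midVec, hr]
  congr 2
  module

lemma dist_sq_one_two (h : r 1 - r 0 ≠ 0) (hr : r 3 = r 2 - ρ • (r 1 - r 0)) :
    dist (r 1) (r 2) ^ 2 = ‖r 1 - r 0‖ ^ 2 *
      (midSq r + ((1 - ρ) / 2) ^ 2 - 2 * midOffset r * ((1 - ρ) / 2)) := by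
  rw [sub_eq_add_neg _ (_ * _), ← mul_neg, ← neg_sq ((1 - ρ) / 2), ← norm_midVec_add_smul_sq h,
    dist_comm, dist_eq_norm, midVec, hr]
  congr 2
  module

lemma dist_sq_zero_one : dist (r 0) (r 1) ^ 2 = ‖r 1 - r 0‖ ^ 2 := by
  rw [dist_comm, dist_eq_norm]

lemma dist_sq_two_three (hr : r 3 = r 2 - ρ • (r 1 - r 0)) :
    dist (r 2) (r 3) ^ 2 = ‖r 1 - r 0‖ ^ 2 * ρ ^ 2 := by
  rw [dist_eq_norm, hr, sub_sub_cancel, norm_smul, mul_pow, Real.norm_eq_abs, sq_abs, mul_comm]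

lemma midOffset_sq_lt_midSq (hr : r 3 = r 2 - ρ • (r 1 - r 0))
    (hc : cross (r 1 - r 0) (r 2 - r 0) ≠ 0) : midOffset r ^ 2 < midSq r := by
  have h : r 1 - r 0 ≠ 0 := by
    intro h
    rw [h] at hc
    simp [cross] at hc
  have hn : 0 < ‖r 1 - r 0‖ := norm_pos_iff.2 h
  have h1 : cross (r 1 - r 0) (r 2 - r 0) = cross (r 1 - r 0) (midVec r) := by
    simp only [cross, midVec, hr, PiLp.sub_apply, PiLp.add_apply, PiLp.smul_apply, smul_eq_mul]
    ring
  have h2 := cross_sq (r 1 - r 0) (midVec r)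
  rw [← h1] at h2
  have h3 : 0 < cross (r 1 - r 0) (r 2 - r 0) ^ 2 := by positivity
  -- Strict Cauchy–Schwarz, the defect being the squared determinant.
  rw [midOffset, midSq, div_pow, div_lt_div_iff₀ (by positivity) (by positivity),
    real_inner_comm]
  nlinarith [pow_pos hn 2]

end

section

variable {r : Fin 4 → Plane} {ρ μ ν : ℝ}

lemma ne_zero_of_cross_ne_zero {v w : Plane} (h : cross v w ≠ 0) : v ≠ 0 := by
  rintro rfl
  simp [cross] at h

lemma trapezoidEquations_iff (hr : r 3 = r 2 - ρ • (r 1 - r 0))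
    (hc : cross (r 1 - r 0) (r 2 - r 0) ≠ 0) :
    TrapezoidEquations ((1 + ρ) / 2) ((1 - ρ) / 2) (midOffset r) (midSq r) ↔
    weight r 0 1 + weight r 2 3 = weight r 0 2 + weight r 1 3 ∧
    weight r 0 1 + weight r 2 3 = weight r 0 3 + weight r 1 2 := by
  have hb := ne_zero_of_cross_ne_zero hc
  have hβ : 0 < ‖r 1 - r 0‖ ^ 2 := pow_pos (norm_pos_iff.2 hb) 2
  have hlt := midOffset_sq_lt_midSq hr hc
  have hP := abs_lt.1 (abs_two_mul_lt (P := (1 + ρ) / 2) hlt)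
  have hQ := abs_lt.1 (abs_two_mul_lt (P := (1 - ρ) / 2) hlt)
  have hinv := (invCube_pos hβ).ne'
  -- Since `P + Q = 1` and `P - Q = ρ`, the common level is the contribution of the two bases. The
  -- scale factor then cancels because `invCube` is multiplicative.
  have hκ : pairSum (((1 + ρ) / 2) ^ 2 + ((1 - ρ) / 2) ^ 2) (2 * ((1 + ρ) / 2) * ((1 - ρ) / 2)) =
      1 + invCube (ρ ^ 2) := by
    have e1 : ((1 + ρ) / 2) ^ 2 + ((1 - ρ) / 2) ^ 2 + 2 * ((1 + ρ) / 2) * ((1 - ρ) / 2) = 1 := by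
      ring
    have e2 : ((1 + ρ) / 2) ^ 2 + ((1 - ρ) / 2) ^ 2 - 2 * ((1 + ρ) / 2) * ((1 - ρ) / 2) =
      ρ ^ 2 := by ring
    rw [pairSum, e1, e2, invCube_one]
  simp only [weight, dist_sq_zero_one, dist_sq_two_three hr, dist_sq_zero_two hb hr,
    dist_sq_one_three hb hr, dist_sq_zero_three hb hr, dist_sq_one_two hb hr]
  rw [TrapezoidEquations, hκ, invCube_mul hβ.le (sq_nonneg _), invCube_mul hβ.le (by linarith),
    invCube_mul hβ.le (by linarith), invCube_mul hβ.le (by linarith),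
    invCube_mul hβ.le (by linarith), ← mul_add, ← mul_add, ← mul_one_add, mul_right_inj' hinv,
    mul_right_inj' hinv]
  simp only [pairSum, hlt, true_and, eq_comm]

lemma TrapezoidEquations.offset_bounds (hρ : ρ ≠ 0)
    (h : TrapezoidEquations ((1 + ρ) / 2) ((1 - ρ) / 2) μ ν) :
    abs (1 - |ρ|) / 2 < |μ| ∧ |μ| < (1 + |ρ|) / 2 := by
  have hne : |(1 + ρ) / 2| ≠ |(1 - ρ) / 2| := by
    intro h
    have := (sq_eq_sq_iff_abs_eq_abs _ _).2 h
    exact hρ (by nlinarith)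
  obtain ⟨μ₀, ν₀, h1, h2, H⟩ := trapezoidEquations_unique hne
  obtain ⟨rfl, -⟩ := (H _ _).1 h
  rw [abs_div, abs_div, abs_two] at h1 h2
  rcases le_or_gt 0 ρ with hs | hs
  · rw [abs_of_nonneg hs]
    rw [abs_of_nonneg (by linarith : (0 : ℝ) ≤ 1 + ρ)] at h1 h2
    have : |1 - ρ| ≤ 1 + ρ := abs_le.2 ⟨by linarith, by linarith⟩
    exact ⟨by rwa [min_eq_right (by linarith)] at h1, by rwa [max_eq_left (by linarith)] at h2⟩
  · rw [abs_of_neg hs, sub_neg_eq_add, ← sub_eq_add_neg]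
    rw [abs_of_nonneg (by linarith : (0 : ℝ) ≤ 1 - ρ)] at h1 h2
    have : |1 + ρ| ≤ 1 - ρ := abs_le.2 ⟨by linarith, by linarith⟩
    exact ⟨by rwa [min_eq_left (by linarith)] at h1, by rwa [max_eq_right (by linarith)] at h2⟩

/-- This expression is the multiplier divided by `y`. For each choice of signs of `ρ` and of the
offset, the two summands have the same strict sign; the relation `s₀₂ + s₁₃ = s₀₃ + s₁₂` between the
weights lets one difference be replaced by another whose sign is visible from `|μ| < (1 + |ρ|) / 2`
or from the signs alone. -/
lemma multiplier_ne_zero (hr : r 3 = r 2 - ρ • (r 1 - r 0))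
    (hc : cross (r 1 - r 0) (r 2 - r 0) ≠ 0) (hρ : ρ ≠ 0)
    (h : TrapezoidEquations ((1 + ρ) / 2) ((1 - ρ) / 2) (midOffset r) (midSq r)) :
    ρ * (weight r 1 2 - weight r 0 2) + (weight r 0 3 - weight r 0 2) ≠ 0 := by
  obtain ⟨h1, h2⟩ := (trapezoidEquations_iff hr hc).1 h
  have hμ : midOffset r ≠ 0 := by
    rw [← abs_pos]
    exact lt_of_le_of_lt (div_nonneg (abs_nonneg _) zero_le_two) (h.offset_bounds hρ).1
  have hb := ne_zero_of_cross_ne_zero hc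
  have hβ : 0 < ‖r 1 - r 0‖ ^ 2 := pow_pos (norm_pos_iff.2 hb) 2
  have hP := abs_lt.1 (abs_two_mul_lt (P := (1 + ρ) / 2) h.1)
  have hQ := abs_lt.1 (abs_two_mul_lt (P := (1 - ρ) / 2) h.1)
  have d02 := dist_sq_zero_two hb hr
  have d13 := dist_sq_one_three hb hr
  have d03 := dist_sq_zero_three hb hr
  have d12 := dist_sq_one_two hb hr
  have p02 : 0 < dist (r 0) (r 2) ^ 2 := by rw [d02]; exact mul_pos hβ (by linarith)
  have p13 : 0 < dist (r 1) (r 3) ^ 2 := by rw [d13]; exact mul_pos hβ (by linarith)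
  have p03 : 0 < dist (r 0) (r 3) ^ 2 := by rw [d03]; exact mul_pos hβ (by linarith)
  have p12 : 0 < dist (r 1) (r 2) ^ 2 := by rw [d12]; exact mul_pos hβ (by linarith)
  have e1 : dist (r 0) (r 2) ^ 2 - dist (r 1) (r 2) ^ 2 =
      ‖r 1 - r 0‖ ^ 2 * (ρ + 2 * midOffset r) := by rw [d02, d12]; ring
  have e2 : dist (r 0) (r 2) ^ 2 - dist (r 0) (r 3) ^ 2 =
      ‖r 1 - r 0‖ ^ 2 * (ρ * (1 + 2 * midOffset r)) := by rw [d02, d03]; ring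
  have e3 : dist (r 1) (r 3) ^ 2 - dist (r 0) (r 3) ^ 2 =
      ‖r 1 - r 0‖ ^ 2 * (ρ - 2 * midOffset r) := by rw [d13, d03]; ring
  have e4 : dist (r 1) (r 3) ^ 2 - dist (r 1) (r 2) ^ 2 =
      ‖r 1 - r 0‖ ^ 2 * (ρ * (1 - 2 * midOffset r)) := by rw [d13, d12]; ring
  rcases hρ.lt_or_gt with hρ | hρ <;> rcases hμ.lt_or_gt with hμ | hμ
  · have k1 : weight r 1 2 < weight r 0 2 := (invCube_lt_iff p12 p02).2 (by nlinarith)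
    have k2 : weight r 1 2 < weight r 1 3 := (invCube_lt_iff p12 p13).2
      (by linarith [mul_neg_of_pos_of_neg hβ (mul_neg_of_neg_of_pos hρ
        (by linarith : 0 < 1 - 2 * midOffset r))])
    have := mul_pos_of_neg_of_neg hρ (sub_neg.2 k1)
    linarith
  · have k1 : weight r 0 3 < weight r 1 3 := (invCube_lt_iff p03 p13).2 (by nlinarith)
    have k2 : weight r 0 3 < weight r 0 2 := (invCube_lt_iff p03 p02).2
      (by linarith [mul_neg_of_pos_of_neg hβ (mul_neg_of_neg_of_pos hρ
        (by linarith : 0 < 1 + 2 * midOffset r))])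
    have := mul_neg_of_neg_of_pos hρ (by linarith : 0 < weight r 1 2 - weight r 0 2)
    linarith
  · have k1 : weight r 1 3 < weight r 0 3 := (invCube_lt_iff p13 p03).2 (by nlinarith)
    have k2 : weight r 1 3 < weight r 1 2 := (invCube_lt_iff p13 p12).2
      (by linarith [mul_pos hβ (mul_pos hρ (by linarith : 0 < 1 - 2 * midOffset r))])
    have := mul_neg_of_pos_of_neg hρ (by linarith : weight r 1 2 - weight r 0 2 < 0)
    linarith
  · have k1 : weight r 0 2 < weight r 1 2 := (invCube_lt_iff p02 p12).2 (by nlinarith)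
    have k2 : weight r 0 2 < weight r 0 3 := (invCube_lt_iff p02 p03).2
      (by linarith [mul_pos hβ (mul_pos hρ (by linarith : 0 < 1 + 2 * midOffset r))])
    have := mul_pos hρ (sub_pos.2 k1)
    linarith

lemma cross_ne_zero_of_not_collinear (hne : r 1 ≠ r 0) (hr : r 3 = r 2 - ρ • (r 1 - r 0))
    (h : ¬ Collinear ℝ (Set.range r)) : cross (r 1 - r 0) (r 2 - r 0) ≠ 0 := by
  intro hc
  obtain ⟨t, ht⟩ := exists_eq_smul_of_cross_eq_zero (sub_ne_zero.2 hne) hc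
  refine h ((collinear_iff_of_mem (Set.mem_range_self 0)).2 ⟨r 1 - r 0, ?_⟩)
  rintro _ ⟨i, rfl⟩
  fin_cases i
  · exact ⟨0, by simp⟩
  · exact ⟨1, by simp⟩
  · exact ⟨t, by simp [← ht]⟩
  · refine ⟨t - ρ, ?_⟩
    simp only [Fin.reduceFinMk, vadd_eq_add]
    rw [hr, sub_smul, ← ht]
    abel

lemma injective_of_cross_ne_zero (hr : r 3 = r 2 - ρ • (r 1 - r 0))
    (hc : cross (r 1 - r 0) (r 2 - r 0) ≠ 0) (hρ : ρ ≠ 0) : Function.Injective r := by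
  have hb := ne_zero_of_cross_ne_zero hc
  have key : ∀ s t : ℝ, t ≠ 0 → s • (r 1 - r 0) + t • (r 2 - r 0) ≠ 0 :=
    fun s t ht h => ht (eq_zero_of_smul_add_smul_eq_zero hc h).2
  have h01 : r 0 ≠ r 1 := fun h => hb (sub_eq_zero.2 h.symm)
  have h23 : r 2 ≠ r 3 := fun h => by
    rw [hr, eq_comm, sub_eq_self, smul_eq_zero] at h
    exact h.elim hρ hb
  have h02 : r 0 ≠ r 2 := fun h => key 0 1 one_ne_zero (by rw [h]; module)
  have h12 : r 1 ≠ r 2 := fun h => key (-1) 1 one_ne_zero (by rw [h]; module)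
  have h03 : r 0 ≠ r 3 := fun h => key (-ρ) 1 one_ne_zero (by
    rw [hr, ← sub_eq_zero] at h
    rw [← neg_eq_zero, ← h]
    module)
  have h13 : r 1 ≠ r 3 := fun h => key (-ρ - 1) 1 one_ne_zero (by
    rw [hr, ← sub_eq_zero] at h
    rw [← neg_eq_zero, ← h]
    module)
  intro i j hij
  by_contra hne
  fin_cases i <;> fin_cases j <;> first | exact hne rfl | skip
  exacts [h01 hij, h02 hij, h03 hij, h01 hij.symm, h12 hij, h13 hij, h02 hij.symm, h12 hij.symm,
    h23 hij, h03 hij.symm, h13 hij.symm, h23 hij.symm]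

end

/-- Non-collinear central configurations of two pairs of opposite masses in terms of the ratio of
the bases and of the relative position of their midpoints. -/
theorem isNoncollinearCentral_iff {x y : ℝ} (hx : x ≠ 0) (hy : y ≠ 0) (r : Fin 4 → Plane) :
    IsNoncollinearCentral ![x, -x, y, -y] r ↔
      r 3 = r 2 - (x / y) • (r 1 - r 0) ∧ cross (r 1 - r 0) (r 2 - r 0) ≠ 0 ∧
      TrapezoidEquations ((1 + x / y) / 2) ((1 - x / y) / 2) (midOffset r) (midSq r) := by
  have hρ : x / y ≠ 0 := div_ne_zero hx hy
  have hxy : x = x / y * y := (div_mul_cancel₀ x hy).symm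
  constructor
  · rintro ⟨hcol, ξ, hξ, hinj, h⟩
    have h0 := center_eq_zero hξ h
    have hr : r 3 = r 2 - (x / y) • (r 1 - r 0) := by
      have h1 : y⁻¹ • (x • (r 1 - r 0) + y • (r 3 - r 2)) = 0 := by rw [h0, smul_zero]
      rw [smul_add, smul_smul, smul_smul, inv_mul_cancel₀ hy, one_smul, mul_comm,
        ← div_eq_mul_inv] at h1
      rw [← sub_eq_zero, ← h1]
      abel
    have hc := cross_ne_zero_of_not_collinear (hinj.ne (by decide)) hr hcol
    obtain ⟨e1, e2, -⟩ := (central_iff hy hr hxy hc hρ).1 h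
    exact ⟨hr, hc, (trapezoidEquations_iff hr hc).2 ⟨e1, e2⟩⟩
  · rintro ⟨hr, hc, h⟩
    obtain ⟨e1, e2⟩ := (trapezoidEquations_iff hr hc).1 h
    refine ⟨fun hcol => hc (cross_eq_zero_of_collinear hcol (Set.mem_range_self 0)
      (Set.mem_range_self 1) (Set.mem_range_self 2)), _,
      mul_ne_zero hy (multiplier_ne_zero hr hc hρ h), injective_of_cross_ne_zero hr hc hρ,
      (central_iff hy hr hxy hc hρ).2 ⟨e1, e2, rfl⟩⟩

/-! ### Bands and semi-balanced trapezoids -/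

lemma mem_band_iff {a b : Plane} (h : b - a ≠ 0) (z : Plane) :
    z ∈ band a b ↔ 0 ≤ inner ℝ (z - a) (b - a) ∧ inner ℝ (z - a) (b - a) ≤ ‖b - a‖ ^ 2 := by
  have hn : 0 < ‖b - a‖ ^ 2 := pow_pos (norm_pos_iff.2 h) 2
  constructor
  · rintro ⟨w, hw, u, hu, rfl⟩
    rw [segment_eq_image'] at hw
    obtain ⟨t, ht, rfl⟩ := hw
    have : inner ℝ (a + t • (b - a) + u - a) (b - a) = t * ‖b - a‖ ^ 2 := by
      rw [show a + t • (b - a) + u - a = t • (b - a) + u by abel, inner_add_left, hu,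
        real_inner_smul_left, real_inner_self_eq_norm_sq, add_zero]
    rw [this]
    exact ⟨mul_nonneg ht.1 hn.le, mul_le_of_le_one_left hn.le ht.2⟩
  · rintro ⟨h0, h1⟩
    refine ⟨a + (inner ℝ (z - a) (b - a) / ‖b - a‖ ^ 2) • (b - a), ?_,
      z - a - (inner ℝ (z - a) (b - a) / ‖b - a‖ ^ 2) • (b - a), ?_, by abel⟩
    · rw [segment_eq_image']
      exact ⟨_, ⟨div_nonneg h0 hn.le, div_le_one_of_le₀ h1 hn.le⟩, rfl⟩
    · rw [inner_sub_left, real_inner_smul_left, real_inner_self_eq_norm_sq,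
        div_mul_cancel₀ _ hn.ne', sub_self]

section

variable {a b c d : Plane} {σ : ℝ}

lemma mem_band_iff_of_parallel (hσ : 0 < σ) (hd : d = c - σ • (b - a)) (h : b - a ≠ 0)
    (z : Plane) : z ∈ band c d ↔
      -(σ * ‖b - a‖ ^ 2) ≤ inner ℝ (z - c) (b - a) ∧ inner ℝ (z - c) (b - a) ≤ 0 := by
  have hdc : d - c = -(σ • (b - a)) := by rw [hd]; abel
  rw [mem_band_iff (by rw [hdc]; exact neg_ne_zero.2 (smul_ne_zero hσ.ne' h)), hdc,
    inner_neg_right, real_inner_smul_right, norm_neg, norm_smul, mul_pow, Real.norm_eq_abs, sq_abs]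
  constructor <;> rintro ⟨h1, h2⟩ <;> constructor <;> nlinarith

lemma isTrapezoid_of_parallel (hσ : 0 < σ) (hd : d = c - σ • (b - a))
    (hc : cross (b - a) (c - a) ≠ 0) : IsTrapezoid a b c d where
  not_collinear h := hc (cross_eq_zero_of_collinear h (by simp) (by simp) (by simp))
  parallel := by
    rw [AffineSubspace.affineSpan_pair_parallel_iff_vectorSpan_eq, vectorSpan_pair_rev,
      vectorSpan_pair_rev, hd, vsub_eq_sub, vsub_eq_sub, sub_sub_cancel_left, ← neg_smul]
    exact (Submodule.span_singleton_smul_eq (neg_ne_zero.2 hσ.ne').isUnit _).symm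
  diagonals_meet := by
    have hs : (0 : ℝ) < 1 + σ := by linarith
    -- The diagonals cut each other in the ratio `1 : σ` of the bases.
    have ht : (1 + σ)⁻¹ ∈ Set.Icc (0 : ℝ) 1 := ⟨by positivity, inv_le_one_of_one_le₀ (by linarith)⟩
    refine ⟨a + (1 + σ)⁻¹ • (c - a), ?_, ?_⟩ <;> rw [segment_eq_image']
    · exact ⟨_, ht, rfl⟩
    · refine ⟨_, ht, ?_⟩
      have h1 : (1 + σ)⁻¹ * (1 + σ) = 1 := inv_mul_cancel₀ hs.ne'
      simp only [hd]
      have : b + (1 + σ)⁻¹ • (c - σ • (b - a) - b) - (a + (1 + σ)⁻¹ • (c - a)) =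
          (1 - (1 + σ)⁻¹ * (1 + σ)) • (b - a) := by module
      rw [h1, sub_self, zero_smul] at this
      exact sub_eq_zero.1 this

/-- Projected on the direction of the bases, in units of `[a, b]`, the bands are intervals of
lengths `1` and `σ` whose centres are `|μ|` apart. The bounds make them overlap without nesting; the
sign of `μ` decides which endpoints witness this. -/
lemma isSemiBalancedTrapezoid_of_offset {μ : ℝ} (hσ : 0 < σ) (hd : d = c - σ • (b - a))
    (hc : cross (b - a) (c - a) ≠ 0)
    (hμ : inner ℝ ((1 / 2 : ℝ) • (c + d) - (1 / 2 : ℝ) • (a + b)) (b - a) = μ * ‖b - a‖ ^ 2)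
    (h1 : |1 - σ| / 2 < |μ|) (h2 : |μ| < (1 + σ) / 2) : IsSemiBalancedTrapezoid a b c d := by
  have hb : b - a ≠ 0 := by
    intro h
    rw [h] at hc
    simp [cross] at hc
  have hβ : 0 < ‖b - a‖ ^ 2 := pow_pos (norm_pos_iff.2 hb) 2
  have hself : inner ℝ (b - a) (b - a) = ‖b - a‖ ^ 2 := real_inner_self_eq_norm_sq _
  have ica : inner ℝ (c - a) (b - a) = (μ + (1 + σ) / 2) * ‖b - a‖ ^ 2 := by
    rw [add_mul, ← hμ, ← hself, ← real_inner_smul_left, ← inner_add_left, hd]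
    congr 1
    module
  have iac : inner ℝ (a - c) (b - a) = -(μ + (1 + σ) / 2) * ‖b - a‖ ^ 2 := by
    rw [← neg_sub c a, inner_neg_left, ica, neg_mul]
  have ibc : inner ℝ (b - c) (b - a) = (-μ + (1 - σ) / 2) * ‖b - a‖ ^ 2 := by
    rw [← sub_add_sub_cancel b a c, inner_add_left, hself, iac]
    ring
  have ida : inner ℝ (d - a) (b - a) = (μ + (1 - σ) / 2) * ‖b - a‖ ^ 2 := by
    rw [hd, sub_right_comm, inner_sub_left, real_inner_smul_left, hself, ica]
    ring
  have m1 := mem_band_iff hb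
  have m2 := mem_band_iff_of_parallel hσ hd hb
  have ma : a ∈ band a b := by rw [m1, sub_self, inner_zero_left]; exact ⟨le_rfl, hβ.le⟩
  have mb : b ∈ band a b := by rw [m1, hself]; exact ⟨hβ.le, le_rfl⟩
  have mc : c ∈ band c d := by
    rw [m2, sub_self, inner_zero_left]
    exact ⟨by nlinarith, le_rfl⟩
  have md : d ∈ band c d := by
    rw [m2, hd, sub_sub_cancel_left, inner_neg_left, real_inner_smul_left, hself]
    exact ⟨le_rfl, by nlinarith⟩
  have l1 := neg_abs_le (1 - σ)
  have l2 := le_abs_self (1 - σ)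
  refine ⟨isTrapezoid_of_parallel hσ hd hc, ?_, ?_⟩
  · rcases le_or_gt 0 μ with hs | hs
    · rw [abs_of_nonneg hs] at h1 h2
      rintro (h | h)
      · have := ((m2 a).1 (h ma)).1
        rw [iac] at this
        nlinarith
      · have := ((m1 c).1 (h mc)).2
        rw [ica] at this
        nlinarith
    · rw [abs_of_neg hs] at h1 h2
      rintro (h | h)
      · have := ((m2 b).1 (h mb)).2
        rw [ibc] at this
        nlinarith
      · have := ((m1 d).1 (h md)).1
        rw [ida] at this
        nlinarith
  · intro h
    rcases le_or_gt 0 μ with hs | hs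
    · rw [abs_of_nonneg hs] at h1 h2
      have : b ∈ band a b ∩ band c d :=
        ⟨mb, (m2 b).2 (by rw [ibc]; constructor <;> nlinarith)⟩
      rw [h] at this
      exact this
    · rw [abs_of_neg hs] at h1 h2
      have : a ∈ band a b ∩ band c d :=
        ⟨ma, (m2 a).2 (by rw [iac]; constructor <;> nlinarith)⟩
      rw [h] at this
      exact this

end

/-! ### Similarity classes are determined by the offset and the squared distance of the midpoints -/

section

variable {r s : Fin 4 → Plane} {ρ : ℝ}

lemma similar_of_parameters_eq (hr : r 3 = r 2 - ρ • (r 1 - r 0)) (hs : s 3 = s 2 - ρ • (s 1 - s 0))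
    (hr0 : r 1 - r 0 ≠ 0) (hs0 : s 1 - s 0 ≠ 0) (hμ : midOffset r = midOffset s)
    (hν : midSq r = midSq s) : Similar r s := by
  have hr' := norm_pos_iff.2 hr0
  have hs' := norm_pos_iff.2 hs0
  have key : ∀ (i j : Fin 4) (A : ℝ), dist (r i) (r j) ^ 2 = ‖r 1 - r 0‖ ^ 2 * A →
      dist (s i) (s j) ^ 2 = ‖s 1 - s 0‖ ^ 2 * A →
      dist (r i) (r j) = ‖r 1 - r 0‖ / ‖s 1 - s 0‖ * dist (s i) (s j) := by
    intro i j A h1 h2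
    rw [← sq_eq_sq₀ dist_nonneg (by positivity), mul_pow, h1, h2, div_pow]
    field_simp
  rw [similar_iff_exists_pos_dist_eq]
  have k01 := key 0 1 1 (by rw [dist_sq_zero_one, mul_one]) (by rw [dist_sq_zero_one, mul_one])
  have k02 := key 0 2 _ (dist_sq_zero_two hr0 hr) (by rw [dist_sq_zero_two hs0 hs, hμ, hν])
  have k03 := key 0 3 _ (dist_sq_zero_three hr0 hr) (by rw [dist_sq_zero_three hs0 hs, hμ, hν])
  have k12 := key 1 2 _ (dist_sq_one_two hr0 hr) (by rw [dist_sq_one_two hs0 hs, hμ, hν])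
  have k13 := key 1 3 _ (dist_sq_one_three hr0 hr) (by rw [dist_sq_one_three hs0 hs, hμ, hν])
  have k23 := key 2 3 _ (dist_sq_two_three hr) (dist_sq_two_three hs)
  have hsymm : ∀ i j, dist (r i) (r j) = ‖r 1 - r 0‖ / ‖s 1 - s 0‖ * dist (s i) (s j) →
      dist (r j) (r i) = ‖r 1 - r 0‖ / ‖s 1 - s 0‖ * dist (s j) (s i) := by
    intro i j h
    rw [dist_comm, h, dist_comm]
  refine ⟨‖r 1 - r 0‖ / ‖s 1 - s 0‖, by positivity, fun i j => ?_⟩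
  fin_cases i <;> fin_cases j <;>
    first
    | assumption
    | exact hsymm _ _ (by assumption)
    | simp

lemma midOffset_eq_of_similar (hr : r 3 = r 2 - ρ • (r 1 - r 0))
    (hs : s 3 = s 2 - ρ • (s 1 - s 0)) (hr0 : r 1 - r 0 ≠ 0) (hs0 : s 1 - s 0 ≠ 0)
    (h : Similar r s) : midOffset r = midOffset s := by
  obtain ⟨k, hk, h⟩ := similar_iff_exists_pos_dist_eq.1 h
  have hs' : 0 < ‖s 1 - s 0‖ ^ 2 := pow_pos (norm_pos_iff.2 hs0) 2
  have h01 : ‖r 1 - r 0‖ ^ 2 = k ^ 2 * ‖s 1 - s 0‖ ^ 2 := by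
    rw [← dist_sq_zero_one, h, mul_pow, dist_sq_zero_one]
  have key : ∀ (i j : Fin 4) (A B : ℝ), dist (r i) (r j) ^ 2 = ‖r 1 - r 0‖ ^ 2 * A →
      dist (s i) (s j) ^ 2 = ‖s 1 - s 0‖ ^ 2 * B → A = B := by
    intro i j A B h1 h2
    rw [h, mul_pow, h2, h01, mul_assoc] at h1
    exact (mul_left_cancel₀ hs'.ne' (mul_left_cancel₀ (pow_pos hk 2).ne' h1)).symm
  have k02 := key 0 2 _ _ (dist_sq_zero_two hr0 hr) (dist_sq_zero_two hs0 hs)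
  have k03 := key 0 3 _ _ (dist_sq_zero_three hr0 hr) (dist_sq_zero_three hs0 hs)
  have k12 := key 1 2 _ _ (dist_sq_one_two hr0 hr) (dist_sq_one_two hs0 hs)
  have k13 := key 1 3 _ _ (dist_sq_one_three hr0 hr) (dist_sq_one_three hs0 hs)
  -- The differences `02 - 13` and `03 - 12` give `4μP` and `4μQ`, and `P + Q = 1`.
  linarith

end

/-! ### Explicit representatives and their reflection -/

/-- The configuration with horizontal bases whose first base is `[-1/2, 1/2]`, and whose second
base has midpoint `(μ, h)` and signed length `-ρ`. -/
noncomputable def trapezoid (ρ μ h : ℝ) : Fin 4 → Plane :=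
  ![!₂[-(1 / 2), 0], !₂[1 / 2, 0], !₂[μ + ρ / 2, h], !₂[μ - ρ / 2, h]]

section

variable (ρ μ h : ℝ)

lemma trapezoid_base : trapezoid ρ μ h 1 - trapezoid ρ μ h 0 = !₂[1, 0] := by
  ext i
  fin_cases i <;> simp [trapezoid]
  norm_num

lemma trapezoid_three : trapezoid ρ μ h 3 =
    trapezoid ρ μ h 2 - ρ • (trapezoid ρ μ h 1 - trapezoid ρ μ h 0) := by
  rw [trapezoid_base]
  ext i
  fin_cases i <;> simp [trapezoid]
  ring

lemma midVec_trapezoid : midVec (trapezoid ρ μ h) = !₂[μ, h] := by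
  ext i
  fin_cases i <;> simp [trapezoid, midVec] <;> ring

lemma midOffset_trapezoid : midOffset (trapezoid ρ μ h) = μ := by
  rw [midOffset, trapezoid_base, midVec_trapezoid, plane_inner, plane_norm_sq]
  simp

lemma midSq_trapezoid : midSq (trapezoid ρ μ h) = μ ^ 2 + h ^ 2 := by
  rw [midSq, trapezoid_base, midVec_trapezoid, plane_norm_sq, plane_norm_sq]
  simp

lemma cross_trapezoid : cross (trapezoid ρ μ h 1 - trapezoid ρ μ h 0)
    (trapezoid ρ μ h 2 - trapezoid ρ μ h 0) = h := by
  rw [trapezoid_base, cross]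
  simp [trapezoid]

lemma reflection_vertical_axis (s t : ℝ) :
    EuclideanGeometry.reflection line[ℝ, (!₂[0, 0] : Plane), !₂[0, 1]] !₂[s, t] = !₂[-s, t] := by
  have h1 : (!₂[s, t] : Plane) = !₂[s, 0] +ᵥ (!₂[0, t] : Plane) := by
    ext i; fin_cases i <;> simp
  rw [h1, EuclideanGeometry.reflection_orthogonal_vadd]
  · ext i; fin_cases i <;> simp
  · have : (!₂[0, t] : Plane) = AffineMap.lineMap (!₂[0, 0] : Plane) !₂[0, 1] t := by
      ext i; fin_cases i <;> simp [AffineMap.lineMap_apply]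
    rw [this]
    exact AffineMap.lineMap_mem_affineSpan_pair _ _ _
  · rw [direction_affineSpan, vectorSpan_pair_rev,
      Submodule.mem_orthogonal_singleton_iff_inner_right, plane_inner]
    simp

lemma trapezoid_partner (i : Fin 4) : trapezoid ρ (-μ) h (partner i) =
    EuclideanGeometry.reflection line[ℝ, (!₂[0, 0] : Plane), !₂[0, 1]] (trapezoid ρ μ h i) := by
  fin_cases i
  · simp [trapezoid, partner, reflection_vertical_axis]
  · simp [trapezoid, partner, reflection_vertical_axis]
  · have := reflection_vertical_axis (μ + ρ / 2) h
    simp only [trapezoid, partner, Fin.reduceFinMk, Matrix.cons_val, this]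
    congr 2
    ring
  · have := reflection_vertical_axis (μ - ρ / 2) h
    simp only [trapezoid, partner, Fin.reduceFinMk, Matrix.cons_val, this]
    congr 2
    ring

end

/-! ### Shape of the solutions -/

section

variable {r : Fin 4 → Plane} {ρ : ℝ}

/-- One of `P`, `Q` vanishes, and its equation reads `pairSum ν 0 = pairSum 1 0`. The midpoints are
then one base length apart, which makes the parallelogram a diamond. -/
lemma TrapezoidEquations.eq_one_of_abs_eq_one {μ ν : ℝ} (hρ : |ρ| = 1)
    (h : TrapezoidEquations ((1 + ρ) / 2) ((1 - ρ) / 2) μ ν) : ν = 1 := by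
  have hν : 0 < ν := (sq_nonneg μ).trans_lt h.1
  have key : pairSum ν 0 = pairSum 1 0 → ν = 1 := by
    intro h
    simp only [pairSum, add_zero, sub_zero] at h
    exact invCube_strictAntiOn.injOn hν (Set.mem_Ioi.2 one_pos) (by linarith)
  rcases (abs_eq zero_le_one).1 hρ with rfl | rfl
  · apply key
    have := h.2.2
    norm_num at this
    exact this
  · apply key
    have := h.2.1
    norm_num at this
    exact this

lemma exists_isSemiBalancedTrapezoid (hρ : ρ ≠ 0) (hr : r 3 = r 2 - ρ • (r 1 - r 0))
    (hc : cross (r 1 - r 0) (r 2 - r 0) ≠ 0)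
    (h : TrapezoidEquations ((1 + ρ) / 2) ((1 - ρ) / 2) (midOffset r) (midSq r)) :
    ∃ k l : Fin 4, (0 < ρ ∧ k = 2 ∧ l = 3 ∨ ρ < 0 ∧ k = 3 ∧ l = 2) ∧
      IsSemiBalancedTrapezoid (r 0) (r 1) (r k) (r l) ∧
      (|ρ| = 1 → IsDiamond (r 0) (r 1) (r k) (r l)) := by
  have hb := ne_zero_of_cross_ne_zero hc
  obtain ⟨h1, h2⟩ := h.offset_bounds hρ
  have hn : ‖r 1 - r 0‖ ^ 2 ≠ 0 := pow_ne_zero 2 (norm_ne_zero_iff.2 hb)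
  have hμ : inner ℝ (midVec r) (r 1 - r 0) = midOffset r * ‖r 1 - r 0‖ ^ 2 :=
    (div_mul_cancel₀ _ hn).symm
  have hsq : ∀ i j i' j', dist (r i) (r j) ^ 2 = dist (r i') (r j') ^ 2 →
    dist (r i) (r j) = dist (r i') (r j') :=
    fun i j i' j' h => (sq_eq_sq₀ dist_nonneg dist_nonneg).1 h
  -- The sign of `ρ` decides whether `[r 2, r 3]` runs along or against `[r 0, r 1]`, hence which
  -- bodies are joined by the diagonals.
  rcases hρ.lt_or_gt with hs | hs
  · rw [abs_of_neg hs] at h1 h2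
    have hd : r 2 = r 3 - (-ρ) • (r 1 - r 0) := by rw [hr]; module
    have hc' : cross (r 1 - r 0) (r 3 - r 0) ≠ 0 := by
      convert hc using 1
      simp only [cross, hr, PiLp.sub_apply, PiLp.smul_apply, smul_eq_mul]
      ring
    have hT := isSemiBalancedTrapezoid_of_offset (neg_pos.2 hs) hd hc'
      (by rw [add_comm (r 3)]; exact hμ) h1 h2
    refine ⟨3, 2, Or.inr ⟨hs, rfl, rfl⟩, hT, fun h3 => ?_⟩
    have hν := h.eq_one_of_abs_eq_one h3
    have hρ1 : ρ = -1 := by rw [abs_of_neg hs] at h3; linarith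
    subst hρ1
    refine ⟨hT.1.not_collinear, by rw [hr]; module, hsq _ _ _ _ ?_, hsq _ _ _ _ ?_,
      hsq _ _ _ _ ?_⟩
    · rw [dist_sq_zero_one, dist_sq_one_three hb hr, hν]; ring
    · rw [dist_comm (r 3), dist_sq_two_three hr, dist_sq_one_three hb hr, hν]; ring
    · rw [dist_comm (r 3), dist_comm _ (r 0), dist_sq_two_three hr, dist_sq_zero_two hb hr, hν]
      ring
  · rw [abs_of_pos hs] at h1 h2
    have hT := isSemiBalancedTrapezoid_of_offset hs hr hc hμ h1 h2
    refine ⟨2, 3, Or.inl ⟨hs, rfl, rfl⟩, hT, fun h3 => ?_⟩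
    have hν := h.eq_one_of_abs_eq_one h3
    have hρ1 : ρ = 1 := by rwa [abs_of_pos hs] at h3
    subst hρ1
    refine ⟨hT.1.not_collinear, by rw [hr]; module, hsq _ _ _ _ ?_, hsq _ _ _ _ ?_,
      hsq _ _ _ _ ?_⟩
    · rw [dist_sq_zero_one, dist_sq_one_two hb hr, hν]; ring
    · rw [dist_sq_two_three hr, dist_sq_one_two hb hr, hν]; ring
    · rw [dist_comm _ (r 0), dist_sq_two_three hr, dist_sq_zero_three hb hr, hν]; ring

lemma dist_two_three (hr : r 3 = r 2 - ρ • (r 1 - r 0)) :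
    dist (r 2) (r 3) = |ρ| * dist (r 0) (r 1) := by
  rw [dist_eq_norm, hr, sub_sub_cancel, norm_smul, Real.norm_eq_abs, dist_comm, dist_eq_norm]

end

end NBody

open NBody in
theorem mainTheorem1 (x y : ℝ) (hx : x ≠ 0) (hy : y ≠ 0) :
    -- exactly two labelled configurations up to similarity
    (∃ p q : Fin 4 → Plane,
      NBody.IsNoncollinearCentral ![x, -x, y, -y] p ∧
      NBody.IsNoncollinearCentral ![x, -x, y, -y] q ∧
      ¬ Similar p q ∧
      (∀ r : Fin 4 → Plane, NBody.IsNoncollinearCentral ![x, -x, y, -y] r →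
        Similar r p ∨ Similar r q) ∧
      -- they are mirror images of each other in a line orthogonal to the bases, each body
      -- being exchanged with the body of opposite mass on the same base
      ∃ a b : Plane, a ≠ b ∧
        inner ℝ (b - a) (p 1 - p 0) = 0 ∧ inner ℝ (b - a) (p 3 - p 2) = 0 ∧
        ∀ i, q (NBody.partner i) = EuclideanGeometry.reflection line[ℝ, a, b] (p i)) ∧
    -- the shape of every such configuration
    ∀ r : Fin 4 → Plane, NBody.IsNoncollinearCentral ![x, -x, y, -y] r →
      (∃ k l : Fin 4, ((k = 2 ∧ l = 3) ∨ (k = 3 ∧ l = 2)) ∧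
        -- bases `[r 0, r 1]` and `[r k, r l]`
        NBody.IsSemiBalancedTrapezoid (r 0) (r 1) (r k) (r l) ∧
        -- bodies on the same diagonal have masses of the same sign
        0 < ![x, -x, y, -y] 0 * ![x, -x, y, -y] k ∧
        0 < ![x, -x, y, -y] 1 * ![x, -x, y, -y] l ∧
        (x = y ∨ x = -y → NBody.IsDiamond (r 0) (r 1) (r k) (r l))) ∧
      (|y| < |x| → dist (r 0) (r 1) < dist (r 2) (r 3)) ∧
      (|x| < |y| → dist (r 2) (r 3) < dist (r 0) (r 1)) := by
  have hρ : x / y ≠ 0 := div_ne_zero hx hy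
  constructor
  · have hne : |(1 + x / y) / 2| ≠ |(1 - x / y) / 2| := by
      intro h
      have := (sq_eq_sq_iff_abs_eq_abs _ _).2 h
      exact hρ (by linarith)
    obtain ⟨μ₀, ν₀, hmin, -, H⟩ := trapezoidEquations_unique hne
    have hμ₀ : 0 < μ₀ := lt_of_le_of_lt (le_min (abs_nonneg _) (abs_nonneg _)) hmin
    have hlt : μ₀ ^ 2 < ν₀ := ((H μ₀ ν₀).2 ⟨abs_of_pos hμ₀, rfl⟩).1
    -- The height of the trapezoid, for a first base of length one.
    have hh : √(ν₀ - μ₀ ^ 2) ≠ 0 := (Real.sqrt_pos.2 (by linarith)).ne'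
    have hh2 : √(ν₀ - μ₀ ^ 2) ^ 2 = ν₀ - μ₀ ^ 2 := Real.sq_sqrt (by linarith)
    generalize √(ν₀ - μ₀ ^ 2) = h at hh hh2
    have hb : ∀ μ, trapezoid (x / y) μ h 1 - trapezoid (x / y) μ h 0 ≠ 0 := fun μ =>
      ne_zero_of_cross_ne_zero (by rw [cross_trapezoid]; exact hh)
    have hν : ∀ μ, |μ| = μ₀ → midSq (trapezoid (x / y) μ h) = ν₀ := by
      intro μ hμ
      rw [midSq_trapezoid, hh2, ← sq_abs, hμ]
      ring
    have hcentral : ∀ μ, |μ| = μ₀ →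
        IsNoncollinearCentral ![x, -x, y, -y] (trapezoid (x / y) μ h) := by
      intro μ hμ
      refine (isNoncollinearCentral_iff hx hy _).2 ⟨trapezoid_three _ _ _, ?_, ?_⟩
      · rw [cross_trapezoid]; exact hh
      · rw [midOffset_trapezoid, hν μ hμ]
        exact (H _ _).2 ⟨hμ, rfl⟩
    have habs : |(-μ₀)| = μ₀ := by rw [abs_neg, abs_of_pos hμ₀]
    have hsim : ∀ r μ, IsNoncollinearCentral ![x, -x, y, -y] r → |μ| = μ₀ → midOffset r = μ →
        Similar r (trapezoid (x / y) μ h) := by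
      intro r μ hr hμ heq
      obtain ⟨hr3, hc, hT⟩ := (isNoncollinearCentral_iff hx hy r).1 hr
      refine similar_of_parameters_eq hr3 (trapezoid_three _ _ _) (ne_zero_of_cross_ne_zero hc)
        (hb μ) ?_ ?_
      · rw [midOffset_trapezoid, heq]
      · rw [hν μ hμ, ((H _ _).1 hT).2]
    refine ⟨trapezoid (x / y) μ₀ h, trapezoid (x / y) (-μ₀) h, hcentral _ (abs_of_pos hμ₀),
      hcentral _ habs, fun hs => ?_, fun r hr => ?_, !₂[0, 0], !₂[0, 1], ?_, ?_, ?_,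
      trapezoid_partner _ _ _⟩
    · have := midOffset_eq_of_similar (trapezoid_three _ _ _) (trapezoid_three _ _ _) (hb _) (hb _)
        hs
      rw [midOffset_trapezoid, midOffset_trapezoid] at this
      linarith
    · obtain ⟨-, -, hT⟩ := (isNoncollinearCentral_iff hx hy r).1 hr
      exact ((abs_eq hμ₀.le).1 ((H _ _).1 hT).1).imp (hsim r _ hr (abs_of_pos hμ₀))
        (hsim r _ hr habs)
    · intro heq
      have := congrArg (fun z : Plane => z 1) heq
      simp at this
    · rw [trapezoid_base, plane_inner]
      simp
    · rw [trapezoid_three, trapezoid_base, plane_inner]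
      simp
  · intro r hr
    obtain ⟨hr3, hc, hT⟩ := (isNoncollinearCentral_iff hx hy r).1 hr
    have hpos : 0 < dist (r 0) (r 1) :=
      dist_pos.2 (sub_ne_zero.1 (ne_zero_of_cross_ne_zero hc)).symm
    obtain ⟨k, l, hkl, hS, hD⟩ := exists_isSemiBalancedTrapezoid hρ hr3 hc hT
    have hxy : x / y * y ^ 2 = x * y := by field_simp
    have hy2 : 0 < y ^ 2 := by positivity
    refine ⟨⟨k, l, ?_, hS, ?_, ?_, fun h => hD ?_⟩, fun h => ?_, fun h => ?_⟩
    · exact hkl.imp And.right And.right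
    · rcases hkl with ⟨h, rfl, rfl⟩ | ⟨h, rfl, rfl⟩ <;> simp <;> nlinarith
    · rcases hkl with ⟨h, rfl, rfl⟩ | ⟨h, rfl, rfl⟩ <;> simp <;> nlinarith
    · rw [abs_div, (abs_eq_abs).2 h, div_self (abs_ne_zero.2 hy)]
    · rw [dist_two_three hr3, abs_div]
      exact lt_mul_of_one_lt_left hpos ((one_lt_div (abs_pos.2 hy)).2 h)
    · rw [dist_two_three hr3, abs_div]
      exact mul_lt_of_lt_one_left hpos ((div_lt_one (abs_pos.2 hy)).2 h)
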